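/- Let $n\in\mathbb N$ and let $f,g,h:\mathbb R^n\to\mathbb R$ be quadratic functions, $$f(x)=x^TAx+2a^Tx+a_0,\qquad g(x)=x^TBx+2b^Tx+b_0,\qquad h(x)=x^TCx+2c^Tx+c_0,$$ where $A,B,C\in\mathbb R^{n\times n}$ are symmetric (possibly zero or indefinite), $a,b,c\in\mathbb R^n$ and $a_0,b_0,c_0\in\mathbb R$. Write $\{g\le 0\}=\{x\in\mathbb R^n: g(x)\le 0\}$, and similarly for the other relations and functions, and let $\mathcal D=\{g\le0\}\cap\{h\le0\}$. Assume the following. 1. If $\mathcal D\subset\{g=0\}$ then $\mathcal D=\{g=0\}$; and if $\mathcal D\subset\{h=0\}$ then $\mathcal D=\{h=0\}$. 2. Either $\{g=0\}\subset\{h\le0\}$ or $\{g=0\}\subset\{h\ge0\}$; and either $\{h=0\}\subset\{g\le0\}$ or $\{h=0\}\subset\{g\ge0\}$. 3. $f,g,h$ are non-constant, $\mathcal D\neq\emptyset$, $\mathcal D\neq\{g\le0\}$ and $\mathcal D\ne\{h\le0\}$. 4. Each of $g,h,-g,-h$ satisfies Slater's condition, i.e. takes a negative value somewhere. 5. If,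 after some invertible affine change of coordinates of $\mathbb R^n$, one of $g,h$ takes the form $-x_1^2+1$ and the other one the form $\bar c_1x_1+\bar c_0$ with $\bar c_1>0$, then $\bar c_0\neq\pm\bar c_1$. Assume moreover that neither $g$ nor $h$ is affine. Then for every $\gamma\in\mathbb R$ the following two statements are equivalent: - $(\mathrm S_1)$ for all $x\in\mathbb R^n$: if $g(x)\le0$ and $h(x)\le0$, then $f(x)\ge\gamma$; - $(\mathrm S_2)$ there exist $\lambda_1\ge0$ and $\lambda_2\ge0$ such that $f(x)-\gamma+\lambda_1g(x)+\lambda_2h(x)\ge0$ for all $x\in\mathbb R^n$. -/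

import Mathlib

open scoped Matrix

/-- `f` is a quadratic function `x ↦ xᵀ A x + 2 aᵀ x + a₀` on `ℝⁿ` with `A` symmetric
(`A = 0` is allowed). -/
def IsQuadraticFunction {n : ℕ} (f : (Fin n → ℝ) → ℝ) : Prop :=
  ∃ (A : Matrix (Fin n) (Fin n) ℝ) (a : Fin n → ℝ) (a₀ : ℝ),
    A.IsSymm ∧ ∀ x, f x = x ⬝ᵥ (A *ᵥ x) + 2 * (a ⬝ᵥ x) + a₀

/-- `f` is an affine function (constants included). -/
def IsAffineFunction {n : ℕ} (f : (Fin n → ℝ) → ℝ) : Prop :=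
  ∃ φ : (Fin n → ℝ) →ᵃ[ℝ] ℝ, ∀ x, f x = φ x

/-- `f` is a constant function. -/
def IsConstantFunction {n : ℕ} (f : (Fin n → ℝ) → ℝ) : Prop :=
  ∃ c : ℝ, ∀ x, f x = c

/-- The feasible domain `D = {g ≤ 0} ∩ {h ≤ 0}`. -/
def feasibleDomain {n : ℕ} (g h : (Fin n → ℝ) → ℝ) : Set (Fin n → ℝ) :=
  {x | g x ≤ 0} ∩ {x | h x ≤ 0}

/-- If `D` lies in the level set `{g = 0}` it equals that level set; the same for `{h = 0}`. -/
def BoundaryCondition {n : ℕ} (g h : (Fin n → ℝ) → ℝ) : Prop :=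
  (feasibleDomain g h ⊆ {x | g x = 0} → feasibleDomain g h = {x | g x = 0}) ∧
  (feasibleDomain g h ⊆ {x | h x = 0} → feasibleDomain g h = {x | h x = 0})

/-- Each of the level sets `{g = 0}`, `{h = 0}` lies on one side of the other. -/
def NonCrossing {n : ℕ} (g h : (Fin n → ℝ) → ℝ) : Prop :=
  ({x | g x = 0} ⊆ {x | h x ≤ 0} ∨ {x | g x = 0} ⊆ {x | h x ≥ 0}) ∧
  ({x | h x = 0} ⊆ {x | g x ≤ 0} ∨ {x | h x = 0} ⊆ {x | g x ≥ 0})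

/-- The three functions are non-constant, `D` is non-empty, and neither constraint is
redundant. -/
def NontrivialProblem {n : ℕ} (f g h : (Fin n → ℝ) → ℝ) : Prop :=
  (¬ IsConstantFunction f ∧ ¬ IsConstantFunction g ∧ ¬ IsConstantFunction h) ∧
  feasibleDomain g h ≠ ∅ ∧
  feasibleDomain g h ≠ {x | g x ≤ 0} ∧
  feasibleDomain g h ≠ {x | h x ≤ 0}

/-- Slater's condition for the constraint `g ≤ 0`. -/
def SlaterCondition {n : ℕ} (g : (Fin n → ℝ) → ℝ) : Prop :=
  ∃ x, g x < 0

/-- Slater's condition for each of `g`, `h`, `-g`, `-h`. -/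
def TwoSidedSlater {n : ℕ} (g h : (Fin n → ℝ) → ℝ) : Prop :=
  SlaterCondition g ∧ SlaterCondition h ∧ SlaterCondition (-g) ∧ SlaterCondition (-h)

/-- In the affine coordinates of `ℝⁿ` given by `T`, the function `p` reads `-xᵢ² + 1` and
`q` reads `c₁ xᵢ + c₀`. -/
def DegeneratesTo {n : ℕ} (p q : (Fin n → ℝ) → ℝ) (T : (Fin n → ℝ) ≃ᵃ[ℝ] (Fin n → ℝ))
    (i : Fin n) (c₁ c₀ : ℝ) : Prop :=
  (∀ x, p (T x) = -(x i) ^ 2 + 1) ∧ (∀ x, q (T x) = c₁ * x i + c₀)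

/-- Whenever, after an invertible affine change of coordinates, one of `g`, `h` becomes
`-x₁² + 1` and the other one `c₁ x₁ + c₀` with `c₁ > 0`, then `c₀ ≠ ± c₁`.  (The name of the
distinguished coordinate is immaterial, so it is any `i`.) -/
def NoPathologicalPair {n : ℕ} (g h : (Fin n → ℝ) → ℝ) : Prop :=
  ∀ (T : (Fin n → ℝ) ≃ᵃ[ℝ] (Fin n → ℝ)) (i : Fin n) (c₁ c₀ : ℝ), 0 < c₁ →
    (DegeneratesTo g h T i c₁ c₀ ∨ DegeneratesTo h g T i c₁ c₀) →
    c₀ ≠ c₁ ∧ c₀ ≠ -c₁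

open Filter Topology

/-! The engine is `s_lemma_equality`: a quadratic that is nonnegative on `{g = 0}`, with `g`
non-affine and of both signs, becomes nonnegative everywhere after adding some `μ * g`, `μ` of
either sign. On a line joining a point of `{g < 0}` to one of `{g > 0}`, this reduces to quadratics
in one variable. Applied to `±h` over `{g = 0}`, it turns the side conditions into a global
inequality between `g` and `h`, which makes both zero sets feasible. Applied to `f - γ` over each
zero set, it gives one multiplier for `g` and one for `h`. A nonnegative one suffices alone; if both
are negative, `f - γ` is already nonnegative everywhere. -/

/-- Two real quadratics with `p 0 < 0 < p 1` and `q ≥ 0` at the two roots of `p`. -/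
theorem quadratic_pair_nonneg {k l m a b c : ℝ} (hk : k ≠ 0) (h0 : m < 0) (h1 : 0 < k + l + m)
    (hq : ∀ s : ℝ, k * s ^ 2 + l * s + m = 0 → 0 ≤ a * s ^ 2 + b * s + c) :
    0 ≤ (a + b + c) * (-m) + c * (k + l + m) := by
  have hdisc : 0 < l ^ 2 - 4 * k * m := by
    rcases lt_or_gt_of_ne hk with h | h
    -- Here `l > -(k + m) > 0`, so the discriminant exceeds `(k - m) ^ 2`.
    · nlinarith [sq_nonneg (k - m)]
    · nlinarith [sq_nonneg l, mul_pos h (neg_pos.2 h0)]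
  obtain ⟨r₁, r₂, hr, hl, hm⟩ : ∃ r₁ r₂ : ℝ, r₁ < r₂ ∧ l = -k * (r₁ + r₂) ∧ m = k * (r₁ * r₂) := by
    set δ := √(l ^ 2 - 4 * k * m)
    have hδ : 0 < δ := Real.sqrt_pos.2 hdisc
    have hδ2 : δ ^ 2 = l ^ 2 - 4 * k * m := Real.sq_sqrt hdisc.le
    have hk2 : 0 < |2 * k| := abs_pos.2 (mul_ne_zero two_ne_zero hk)
    have hε : (δ / |2 * k|) ^ 2 = (l ^ 2 - 4 * k * m) / (4 * k ^ 2) := by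
      rw [div_pow, sq_abs, hδ2]; ring
    refine ⟨-l / (2 * k) - δ / |2 * k|, -l / (2 * k) + δ / |2 * k|, ?_, ?_, ?_⟩
    · linarith [div_pos hδ hk2]
    · field_simp; ring
    · have : (-l / (2 * k) - δ / |2 * k|) * (-l / (2 * k) + δ / |2 * k|)
          = (-l / (2 * k)) ^ 2 - (δ / |2 * k|) ^ 2 := by ring
      rw [this, hε]; field_simp; ring
  have e₁ := hq r₁ (by rw [hl, hm]; ring)
  have e₂ := hq r₂ (by rw [hl, hm]; ring)
  have hd : 0 < r₂ - r₁ := sub_pos.2 hr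
  -- The target is a combination of the values of the second quadratic at the roots. The weights are
  -- nonnegative because `0 < r₁ < 1 < r₂` if `k < 0`, and `r₁ < 0 < r₂ < 1` if `k > 0`.
  have key : (r₂ - r₁) * ((a + b + c) * (-m) + c * (k + l + m))
      = (-k * (r₁ * (1 - r₁))) * (a * r₂ ^ 2 + b * r₂ + c)
        + (k * (r₂ * (1 - r₂))) * (a * r₁ ^ 2 + b * r₁ + c) := by
    rw [hl, hm]; ring
  have h1' : 0 < k * ((1 - r₁) * (1 - r₂)) := by rw [hl, hm] at h1; linarith
  rw [hm] at h0
  have signs : 0 ≤ -k * (r₁ * (1 - r₁)) ∧ 0 ≤ k * (r₂ * (1 - r₂)) := by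
    rcases lt_or_gt_of_ne hk with h | h
    · have hp : 0 < r₁ * r₂ := by by_contra! hc; nlinarith
      have hp' : (1 - r₁) * (1 - r₂) < 0 := by by_contra! hc; nlinarith
      have hr₁ : r₁ < 1 := by by_contra! hc; nlinarith
      have hr₂ : 1 < r₂ := by by_contra! hc; nlinarith
      have hr₀ : 0 < r₁ := by by_contra! hc; nlinarith
      exact ⟨mul_nonneg (by linarith) (mul_nonneg hr₀.le (by linarith)),
        mul_nonneg_of_nonpos_of_nonpos h.le
          (mul_nonpos_of_nonneg_of_nonpos (by linarith) (by linarith))⟩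
    · have hp : r₁ * r₂ < 0 := by by_contra! hc; nlinarith
      have hp' : 0 < (1 - r₁) * (1 - r₂) := by by_contra! hc; nlinarith
      have hr₁ : r₁ < 0 := by by_contra! hc; nlinarith
      have hr₂ : 0 < r₂ := by by_contra! hc; nlinarith
      have hr₀ : r₂ < 1 := by by_contra! hc; nlinarith
      exact ⟨mul_nonneg_of_nonpos_of_nonpos (by linarith)
          (mul_nonpos_of_nonpos_of_nonneg hr₁.le (by linarith)),
        mul_nonneg h.le (mul_nonneg hr₂.le (by linarith))⟩
  refine nonneg_of_mul_nonneg_right (a := r₂ - r₁) ?_ hd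
  rw [key]
  exact add_nonneg (mul_nonneg signs.1 e₂) (mul_nonneg signs.2 e₁)

namespace IsQuadraticFunction

variable {n : ℕ} {f g : (Fin n → ℝ) → ℝ}

theorem continuous (hf : IsQuadraticFunction f) : Continuous f := by
  obtain ⟨A, a, a₀, -, h⟩ := hf
  rw [funext h]
  fun_prop

theorem neg (hf : IsQuadraticFunction f) : IsQuadraticFunction (-f) := by
  obtain ⟨A, a, a₀, hA, h⟩ := hf
  refine ⟨-A, -a, -a₀, hA.neg, fun x => ?_⟩
  simp only [Pi.neg_apply, h, Matrix.neg_mulVec, dotProduct_neg, neg_dotProduct]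
  ring

theorem sub_const (hf : IsQuadraticFunction f) (γ : ℝ) :
    IsQuadraticFunction fun x => f x - γ := by
  obtain ⟨A, a, a₀, hA, h⟩ := hf
  exact ⟨A, a, a₀ - γ, hA, fun x => by simp only [h]; ring⟩

/-- `Q` is the purely quadratic part: the leading coefficient along a line depends only on its
direction. The second clause serves to perturb a direction on which `Q` vanishes. -/
theorem exists_leading (hf : IsQuadraticFunction f) :
    ∃ Q : (Fin n → ℝ) → ℝ,
      (∀ y d, ∃ b : ℝ, ∀ s : ℝ, f (y + s • d) = Q d * s ^ 2 + b * s + f y) ∧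
      (∀ d e, ∃ b : ℝ, ∀ t : ℝ, Q (d + t • e) = Q e * t ^ 2 + b * t + Q d) ∧
      ((∀ d, Q d = 0) → IsAffineFunction f) := by
  obtain ⟨A, a, a₀, -, h⟩ := hf
  refine ⟨fun d => d ⬝ᵥ (A *ᵥ d), fun y d => ?_, fun d e => ?_, fun h0 => ?_⟩
  · refine ⟨y ⬝ᵥ (A *ᵥ d) + d ⬝ᵥ (A *ᵥ y) + 2 * (a ⬝ᵥ d), fun s => ?_⟩
    simp only [h, Matrix.mulVec_add, Matrix.mulVec_smul, dotProduct_add, add_dotProduct,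
      dotProduct_smul, smul_dotProduct, smul_eq_mul]
    ring
  · refine ⟨d ⬝ᵥ (A *ᵥ e) + e ⬝ᵥ (A *ᵥ d), fun t => ?_⟩
    simp only [Matrix.mulVec_add, Matrix.mulVec_smul, dotProduct_add, add_dotProduct,
      dotProduct_smul, smul_dotProduct, smul_eq_mul]
    ring
  · refine ⟨{ toFun := fun x => 2 * (a ⬝ᵥ x) + a₀
              linear := (2 : ℝ) • dotProductBilin ℝ ℝ a
              map_vadd' := fun p v => ?_ }, fun x => ?_⟩
    · simp [dotProduct_add]; ring
    · have := h0 x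
      simp only [h, AffineMap.coe_mk]
      linarith

/-- The separation inequality behind the S-lemma with equality. -/
theorem separation (hf : IsQuadraticFunction f) (hg : IsQuadraticFunction g)
    (hga : ¬ IsAffineFunction g) (hfg : ∀ x, g x = 0 → 0 ≤ f x) {x y : Fin n → ℝ}
    (hx : 0 < g x) (hy : g y < 0) : 0 ≤ f x * (-g y) + f y * g x := by
  obtain ⟨Q, hQ, hQ', hQa⟩ := hg.exists_leading
  obtain ⟨P, hP, -, -⟩ := hf.exists_leading
  obtain ⟨e, he⟩ : ∃ e, Q e ≠ 0 := by
    by_contra! hc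
    exact hga (hQa hc)
  have hgc := hg.continuous
  have hfc := hf.continuous
  have hpt : ∀ x' : Fin n → ℝ, 0 < g x' → Q (x' - y) ≠ 0 →
      0 ≤ f x' * (-g y) + f y * g x' := by
    intro x' hx' hne
    obtain ⟨b, hb⟩ := hQ y (x' - y)
    obtain ⟨c, hc⟩ := hP y (x' - y)
    have hg1 := hb 1
    have hf1 := hc 1
    simp only [one_smul, add_sub_cancel, one_pow, mul_one] at hg1 hf1
    have := quadratic_pair_nonneg (a := P (x' - y)) (b := c) (c := f y) hne hy (hg1 ▸ hx')
      (fun s hs => by rw [← hc]; exact hfg _ (by rw [hb, hs]))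
    rwa [← hg1, ← hf1] at this
  have hcurve : Continuous fun t : ℝ => x + t • e := by fun_prop
  -- If `Q (x - y) = 0`, then `g` has at most one root on the line and the two-root argument fails;
  -- so `x` is moved along `e` and the inequality is passed to the limit.
  have hlim : Tendsto (fun t : ℝ => f (x + t • e) * (-g y) + f y * g (x + t • e)) (𝓝[≠] 0)
      (𝓝 (f x * (-g y) + f y * g x)) := by
    have hcont : Continuous fun t : ℝ => f (x + t • e) * (-g y) + f y * g (x + t • e) := by
      fun_prop
    simpa using (hcont.tendsto 0).mono_left nhdsWithin_le_nhds
  have hpos : ∀ᶠ t in 𝓝[≠] (0 : ℝ), 0 < g (x + t • e) := by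
    refine nhdsWithin_le_nhds (((hgc.comp hcurve).tendsto 0).eventually_const_lt ?_)
    simpa using hx
  have hne : ∀ᶠ t in 𝓝[≠] (0 : ℝ), Q (x + t • e - y) ≠ 0 := by
    obtain ⟨b, hb⟩ := hQ' (x - y) e
    have hrw : ∀ t : ℝ, Q (x + t • e - y) = Q e * t ^ 2 + b * t + Q (x - y) := fun t => by
      rw [← hb, add_sub_right_comm]
    simp only [hrw]
    -- A polynomial in `t` with leading coefficient `Q e ≠ 0` has no zeros in a punctured
    -- neighbourhood of `0`; the cases follow its order of vanishing there.
    by_cases h0 : Q (x - y) = 0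
    · by_cases hb0 : b = 0
      · filter_upwards [self_mem_nhdsWithin] with t ht
        simpa [h0, hb0, he] using ht
      · have hc : Continuous fun t : ℝ => Q e * t + b := by fun_prop
        have : ∀ᶠ t in 𝓝[≠] (0 : ℝ), Q e * t + b ≠ 0 :=
          nhdsWithin_le_nhds ((hc.tendsto 0).eventually_ne (by simpa using hb0))
        filter_upwards [self_mem_nhdsWithin, this] with t ht ht'
        have : Q e * t ^ 2 + b * t + Q (x - y) = t * (Q e * t + b) := by rw [h0]; ring
        rw [this]
        exact mul_ne_zero ht ht'
    · have hc : Continuous fun t : ℝ => Q e * t ^ 2 + b * t + Q (x - y) := by fun_prop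
      exact nhdsWithin_le_nhds ((hc.tendsto 0).eventually_ne (by simpa using h0))
  refine ge_of_tendsto hlim ?_
  filter_upwards [hpos, hne] with t h1 h2 using hpt _ h1 h2

/-- The S-lemma with equality, for a non-affine constraint. -/
theorem s_lemma_equality (hf : IsQuadraticFunction f) (hg : IsQuadraticFunction g)
    (hga : ¬ IsAffineFunction g) (hneg : ∃ x, g x < 0) (hpos : ∃ x, 0 < g x)
    (hfg : ∀ x, g x = 0 → 0 ≤ f x) : ∃ μ : ℝ, ∀ x, 0 ≤ f x + μ * g x := by
  obtain ⟨y₀, hy₀⟩ := hneg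
  obtain ⟨x₀, hx₀⟩ := hpos
  have hsep : ∀ x y, 0 < g x → g y < 0 → -f x / g x ≤ f y / (-g y) := fun x y hx hy => by
    rw [div_le_div_iff₀ hx (neg_pos.2 hy)]
    linarith [separation hf hg hga hfg hx hy]
  -- Points with `g > 0` bound `μ` from below, points with `g < 0` from above; by `hsep` the
  -- supremum of the lower bounds meets both.
  set S : Set ℝ := {r | ∃ x, 0 < g x ∧ r = -f x / g x}
  have hS : S.Nonempty := ⟨_, x₀, hx₀, rfl⟩
  have hub : ∀ y, g y < 0 → ∀ r ∈ S, r ≤ f y / (-g y) := by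
    rintro y hy r ⟨x, hx, rfl⟩
    exact hsep x y hx hy
  have hbdd : BddAbove S := ⟨_, hub y₀ hy₀⟩
  refine ⟨sSup S, fun x => ?_⟩
  rcases lt_trichotomy (g x) 0 with h | h | h
  · have := csSup_le hS (hub x h)
    rw [le_div_iff₀ (neg_pos.2 h)] at this
    linarith
  · simpa [h] using hfg x h
  · have := le_csSup hbdd ⟨x, h, rfl⟩
    rw [div_le_iff₀ h] at this
    linarith

end IsQuadraticFunction

theorem theorem4p2 {n : ℕ} (f g h : (Fin n → ℝ) → ℝ)
    (hf : IsQuadraticFunction f) (hg : IsQuadraticFunction g) (hh : IsQuadraticFunction h)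
    (h_boundary : BoundaryCondition g h)
    (h_noncrossing : NonCrossing g h)
    (h_nontrivial : NontrivialProblem f g h)
    (h_slater : TwoSidedSlater g h)
    (h_nopath : NoPathologicalPair g h)
    (hg_affine : ¬ IsAffineFunction g) (hh_affine : ¬ IsAffineFunction h)
    (γ : ℝ) :
    (∀ x, g x ≤ 0 ∧ h x ≤ 0 → f x ≥ γ) ↔
      ∃ l₁ l₂ : ℝ, 0 ≤ l₁ ∧ 0 ≤ l₂ ∧ ∀ x, f x - γ + l₁ * g x + l₂ * h x ≥ 0 := by
  constructor
  swap
  · rintro ⟨l₁, l₂, h₁, h₂, hl⟩ x ⟨hgx, hhx⟩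
    linarith [hl x, mul_nonpos_of_nonneg_of_nonpos h₁ hgx, mul_nonpos_of_nonneg_of_nonpos h₂ hhx]
  intro hS
  obtain ⟨hgn, hhn, ⟨xg, hxg⟩, ⟨xh, hxh⟩⟩ := h_slater
  have hgp : ∃ x, 0 < g x := ⟨xg, neg_lt_zero.1 hxg⟩
  have hhp : ∃ x, 0 < h x := ⟨xh, neg_lt_zero.1 hxh⟩
  obtain ⟨-, -, hDg, hDh⟩ := h_nontrivial
  -- It suffices that both zero sets are feasible.
  suffices hfeas : (∀ x, g x = 0 → h x ≤ 0) ∧ (∀ x, h x = 0 → g x ≤ 0) by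
    obtain ⟨l₁, hl₁⟩ := (hf.sub_const γ).s_lemma_equality hg hg_affine hgn hgp
      (fun x hx => sub_nonneg.2 (hS x ⟨hx.le, hfeas.1 x hx⟩))
    obtain ⟨l₂, hl₂⟩ := (hf.sub_const γ).s_lemma_equality hh hh_affine hhn hhp
      (fun x hx => sub_nonneg.2 (hS x ⟨hfeas.2 x hx, hx.le⟩))
    rcases le_or_gt 0 l₁ with h₁ | h₁
    · exact ⟨l₁, 0, h₁, le_rfl, fun x => by linarith [hl₁ x]⟩
    rcases le_or_gt 0 l₂ with h₂ | h₂
    · exact ⟨0, l₂, le_rfl, h₂, fun x => by linarith [hl₂ x]⟩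
    refine ⟨0, 0, le_rfl, le_rfl, fun x => ?_⟩
    rcases le_or_gt (g x) 0 with hgx | hgx
    · rcases le_or_gt (h x) 0 with hhx | hhx
      · linarith [hS x ⟨hgx, hhx⟩]
      · linarith [hl₂ x, mul_neg_of_neg_of_pos h₂ hhx]
    · linarith [hl₁ x, mul_neg_of_neg_of_pos h₁ hgx]
  rcases h_noncrossing.1 with hside | hside
  · obtain ⟨μ, hμ⟩ := hh.neg.s_lemma_equality hg hg_affine hgn hgp
      (fun x hx => neg_nonneg.2 (hside hx))
    simp only [Pi.neg_apply] at hμ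
    -- Otherwise `h ≤ μ * g` would make the constraint on `h` redundant.
    have hμ0 : μ < 0 := by
      by_contra! hc
      refine hDg (Set.inter_eq_left.2 fun x (hx : g x ≤ 0) => ?_)
      change h x ≤ 0
      linarith [hμ x, mul_nonpos_of_nonneg_of_nonpos hc hx]
    refine ⟨fun x hx => hside hx, fun x hx => ?_⟩
    by_contra! hc
    linarith [hμ x, mul_neg_of_neg_of_pos hμ0 hc]
  · obtain ⟨μ, hμ⟩ := hh.s_lemma_equality hg hg_affine hgn hgp (fun x hx => hside hx)
    have hμ0 : 0 < μ := by
      by_contra! hc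
      rcases hc.eq_or_lt with rfl | hc
      · obtain ⟨x, hx⟩ := hhn
        linarith [hμ x]
      · refine hDh (Set.inter_eq_right.2 fun x (hx : h x ≤ 0) => ?_)
        change g x ≤ 0
        by_contra! hgx
        linarith [hμ x, mul_neg_of_neg_of_pos hc hgx]
    -- From `h ≥ -μ * g` with `μ > 0`, both functions vanish on the feasible set, so the boundary
    -- condition identifies it with both zero sets.
    have hDh0 : feasibleDomain g h = {x | h x = 0} := by
      refine h_boundary.2 fun x ⟨(hgx : g x ≤ 0), (hhx : h x ≤ 0)⟩ => ?_
      exact le_antisymm hhx (by linarith [hμ x, mul_nonpos_of_nonneg_of_nonpos hμ0.le hgx])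
    have hDg0 : feasibleDomain g h = {x | g x = 0} := by
      refine h_boundary.1 fun x ⟨(hgx : g x ≤ 0), (hhx : h x ≤ 0)⟩ => ?_
      refine le_antisymm hgx ?_
      by_contra! hc
      linarith [hμ x, mul_neg_of_pos_of_neg hμ0 hc]
    exact ⟨fun x hx => (hDg0.symm ▸ hx : x ∈ feasibleDomain g h).2,
      fun x hx => (hDh0.symm ▸ hx : x ∈ feasibleDomain g h).1⟩
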